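/- Let $n\in\mathbb{N}$. For $a=(a_1,\dots,a_n)\in\mathbb{C}^n$ let $P_a=x^n+a_1x^{n-1}+\cdots+a_n\in\mathbb{C}[x]$, and let $D=\{a\in\mathbb{C}^n:\operatorname{Res}(P_a,P_a',x)=0\}$ be the discriminant set, i.e. the set of those $a$ for which $P_a$ has a multiple root. For $1\le k\le n$ put $a^k=(a_1,\dots,a_{k-1},a_{k+1},\dots,a_n)$. We say that $D$ is locally at $A\in D$ the graph of an analytic function in $a^k$ if there is a complex analytic function $\varphi$, defined near $A^k$, such that for all $a$ in some neighbourhood of $A$ one has $a\in D$ if and only if $a_k=\varphi(a^k)$. We say that $D$ is smooth at $A\in D$ if in some neighbourhood of $A$ it is the zero set of a complex analytic function whose differential at $A$ is nonzero. Let $A\in D$. (1) Suppose that $P_A$ has a double root $\lambda$ and that its $n-2$ other roots are simple. (i) If $\lambda\neq 0$, then $A_{n-1}=A_n=0$ does not hold, and for every $k=1,\dots,n$ the set $D$ is locally at $A$ the graph of an analytic function in $a^k$. (ii) If $\lambda=0$, then $D$ is locally at $A$ the graph of an analytic function in $a^k$ for $k=n$, and it is not for any $k=1,\dots,n-1$.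 (2) Suppose that $P_A$ has a root of multiplicity at least $3$. Then the hypersurface $D$ is not smooth at $A$. -/

import Mathlib

open Polynomial Topology

noncomputable section

/-- The monic polynomial `x ^ n + a₁ x ^ (n - 1) + ⋯ + aₙ`. The coefficient `a_k` of the usual
numbering `1, …, n` is the value `a i` at the index `i = k - 1` of `Fin n`. -/
def monicPoly {n : ℕ} (a : Fin n → ℂ) : ℂ[X] :=
  X ^ n + ∑ i : Fin n, C (a i) * X ^ (n - 1 - (i : ℕ))

/-- The discriminant set `D`: the coefficient vectors `a` with `Res(P, P', x) = 0`. -/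
def discriminantSet (n : ℕ) : Set (Fin n → ℂ) :=
  {a | resultant (monicPoly a) (derivative (monicPoly a)) = 0}

/-- The vector of all the coefficients except the one with index `k`. -/
def omitCoeff {n : ℕ} (k : Fin n) (a : Fin n → ℂ) : {j : Fin n // j ≠ k} → ℂ :=
  fun j => a j

/-- Near the point `A`, the set `D` is the graph `a_k = φ(all the other coordinates)` of a function
`φ` that is complex analytic near the projection of `A`. -/
def IsLocallyAnalyticGraph {n : ℕ} (D : Set (Fin n → ℂ)) (A : Fin n → ℂ) (k : Fin n) : Prop :=
  ∃ φ : ({j : Fin n // j ≠ k} → ℂ) → ℂ,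
    AnalyticAt ℂ φ (omitCoeff k A) ∧ ∀ᶠ a in 𝓝 A, a ∈ D ↔ a k = φ (omitCoeff k a)

/-- `D` is a smooth complex hypersurface at its point `A`: near `A` it is the zero set of an
analytic function whose differential at `A` does not vanish. -/
def IsSmoothHypersurfaceAt {n : ℕ} (D : Set (Fin n → ℂ)) (A : Fin n → ℂ) : Prop :=
  ∃ f : (Fin n → ℂ) → ℂ,
    AnalyticAt ℂ f A ∧ fderiv ℂ f A ≠ 0 ∧ ∀ᶠ a in 𝓝 A, a ∈ D ↔ f a = 0

/-- `P` has the double root `r`, and all its other roots are simple. -/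
def HasDoubleRootOthersSimple (P : ℂ[X]) (r : ℂ) : Prop :=
  P.rootMultiplicity r = 2 ∧ ∀ s : ℂ, s ≠ r → P.IsRoot s → P.rootMultiplicity s = 1

end

/-! A point `a` lies in `D` exactly when `P_a` and `P_a'` have a common root `x`, so `D` is the
projection of the zero set of `(P_a(x), P_a'(x))`. At a double root `r` with the others simple, the
map `(a, x) ↦ (a^k, P_a(x), P_a'(x))` has invertible differential at `(A, r)` if the coefficient of
`a_k`, a power of `r`, is nonzero there; the inverse function theorem then gives the graph
(`isLocallyAnalyticGraph_of_eval_ne_zero`). If `r = 0` and `k` is not the last index, `D` contains a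
curve through `A` tangent to the `a_k` axis, which no graph over `a^k` allows. At a root of
multiplicity `m + 1 ≥ 3`, write `P_A = (x - r)^(m+1) q`. Any analytic `f` vanishing on `D` has
differential zero on multiples of `(x - r)^2` (lines in `D`) and on `q` and `(x - r) q` (a curve in
`D` with moving double root). These span all polynomials of degree less than `n`, as `q(r) ≠ 0`. -/

/-- The coefficients of `p` of degree less than `n`, indexed as in `monicPoly`. -/
noncomputable def coeffVec (n : ℕ) : ℂ[X] →ₗ[ℂ] (Fin n → ℂ) :=
  LinearMap.pi fun i => lcoeff ℂ (n - 1 - (i : ℕ))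

@[simp] theorem coeffVec_apply (n : ℕ) (p : ℂ[X]) (i : Fin n) :
    coeffVec n p i = p.coeff (n - 1 - (i : ℕ)) := rfl

theorem sum_coeffVec {n : ℕ} {p : ℂ[X]} (hp : p.degree < (n : WithBot ℕ)) :
    ∑ i : Fin n, C (coeffVec n p i) * X ^ (n - 1 - (i : ℕ)) = p := by
  simp only [coeffVec_apply]
  rw [Fin.sum_univ_eq_sum_range (fun i => C (p.coeff (n - 1 - i)) * X ^ (n - 1 - i)) n,
    Finset.sum_range_reflect (fun i => C (p.coeff i) * X ^ i) n]
  ext j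
  simp only [finsetSum_coeff, coeff_C_mul_X_pow, Finset.sum_ite_eq, Finset.mem_range]
  split_ifs with h
  · rfl
  · exact (coeff_eq_zero_of_degree_lt (hp.trans_le (by exact_mod_cast not_lt.1 h))).symm

theorem degree_sum_lt {n : ℕ} (v : Fin n → ℂ) :
    (∑ i : Fin n, C (v i) * X ^ (n - 1 - (i : ℕ))).degree < (n : WithBot ℕ) := by
  rw [← mem_degreeLT]
  refine Submodule.sum_mem _ fun i _ => mem_degreeLT.2 ?_
  refine (degree_C_mul_X_pow_le _ _).trans_lt ?_
  exact_mod_cast (by omega : n - 1 - (i : ℕ) < n)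

theorem coeffVec_sum {n : ℕ} (v : Fin n → ℂ) :
    coeffVec n (∑ i : Fin n, C (v i) * X ^ (n - 1 - (i : ℕ))) = v := by
  ext j
  simp only [coeffVec_apply, finsetSum_coeff, coeff_C_mul_X_pow]
  rw [Finset.sum_eq_single j]
  · simp
  · intro i _ hij
    rw [if_neg]
    intro h
    exact hij (Fin.ext (by omega))
  · simp

theorem monicPoly_add_coeffVec {n : ℕ} (a : Fin n → ℂ) {p : ℂ[X]} (hp : p.degree < (n : WithBot ℕ)) :
    monicPoly (a + coeffVec n p) = monicPoly a + p := by
  conv_rhs => rw [← sum_coeffVec hp]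
  simp [monicPoly, add_mul, Finset.sum_add_distrib, add_assoc]

theorem monicPoly_monic {n : ℕ} (a : Fin n → ℂ) : (monicPoly a).Monic :=
  monic_X_pow_add (degree_sum_lt a)

theorem natDegree_monicPoly {n : ℕ} (a : Fin n → ℂ) : (monicPoly a).natDegree = n := by
  refine natDegree_eq_of_degree_eq_some ?_
  rw [monicPoly, degree_add_eq_left_of_degree_lt] <;> rw [degree_X_pow]
  exact degree_sum_lt a

theorem coeffVec_monicPoly {n : ℕ} (a : Fin n → ℂ) : coeffVec n (monicPoly a) = a := by
  rw [monicPoly, map_add, coeffVec_sum]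
  ext i
  simp [coeff_X_pow]
  omega

theorem coeffVec_X_pow {n : ℕ} (k : Fin n) :
    coeffVec n (X ^ (n - 1 - (k : ℕ))) = Pi.single k 1 := by
  ext j
  rw [coeffVec_apply, coeff_X_pow, Pi.single_apply]
  refine if_congr ⟨fun h => Fin.ext (by omega), fun h => by rw [h]⟩ rfl rfl

/-! ### Common roots of `P` and `P'` -/

theorem mem_discriminantSet_iff {n : ℕ} {a : Fin n → ℂ} :
    a ∈ discriminantSet n ↔
      ∃ x, (monicPoly a).eval x = 0 ∧ (derivative (monicPoly a)).eval x = 0 := by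
  have h0 := (monicPoly_monic a).ne_zero
  rw [discriminantSet, Set.mem_ofPred_eq, resultant_eq_zero_iff]
  constructor
  · rintro ⟨-, h⟩
    by_contra! hx
    refine h ((isCoprime_iff_aeval_ne_zero_of_isAlgClosed ℂ ℂ _ _).2 fun x => ?_)
    simpa [coe_aeval_eq_eval, or_iff_not_imp_left] using hx x
  · rintro ⟨x, hx, hx'⟩
    refine ⟨.inl h0, fun ⟨u, v, h⟩ => ?_⟩
    have := congrArg (eval x) h
    simp [hx, hx'] at this

theorem norm_le_of_isRoot {n : ℕ} {a : Fin n → ℂ} {x : ℂ} (hx : (monicPoly a).eval x = 0) :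
    ‖x‖ ≤ ‖a‖ + 1 := by
  have h := IsRoot.norm_lt_cauchyBound (monicPoly_monic a).ne_zero hx
  have h2 : cauchyBound (monicPoly a) ≤ ‖a‖₊ + 1 := by
    rw [cauchyBound, monicPoly_monic a, nnnorm_one, div_one, natDegree_monicPoly]
    gcongr
    refine Finset.sup_le fun i hi => ?_
    have hi := Finset.mem_range.1 hi
    have h3 := congrFun (coeffVec_monicPoly a) ⟨n - 1 - i, by omega⟩
    rw [coeffVec_apply, show n - 1 - (n - 1 - i) = i by omega] at h3
    rw [h3]
    exact nnnorm_le_pi_nnnorm a _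
  exact_mod_cast (h.trans_le h2).le

-- An affine family `q + ∑ aᵢ pᵢ` covers both `P_a` and its derivative.
open scoped ContDiff in
theorem contDiff_eval_family {n : ℕ} (q : ℂ[X]) (p : Fin n → ℂ[X]) :
    ContDiff ℂ ω fun z : (Fin n → ℂ) × ℂ => (q + ∑ i, C (z.1 i) * p i).eval z.2 := by
  have h (q : ℂ[X]) : ContDiff ℂ ω fun z : (Fin n → ℂ) × ℂ => q.eval z.2 := by
    have h1 := (q.contDiff_aeval (𝕜 := ℂ) ω).comp (contDiff_snd (E := Fin n → ℂ) (F := ℂ))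
    simp only [coe_aeval_eq_eval] at h1
    exact h1
  simp only [eval_add, eval_finsetSum, eval_mul, eval_C]
  exact (h q).add (ContDiff.sum fun i _ =>
    ((contDiff_apply ℂ ℂ i).comp contDiff_fst).mul (h (p i)))

theorem exists_hasFDerivAt_eval_family {n : ℕ} (q : ℂ[X]) (p : Fin n → ℂ[X])
    (A : Fin n → ℂ) (r : ℂ) :
    ∃ L : (Fin n → ℂ) × ℂ →L[ℂ] ℂ,
      HasFDerivAt (fun z : (Fin n → ℂ) × ℂ => (q + ∑ i, C (z.1 i) * p i).eval z.2) L (A, r) ∧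
      ∀ v y, L (v, y) =
        ∑ i, v i * (p i).eval r + y * (derivative (q + ∑ i, C (A i) * p i)).eval r := by
  have h (q : ℂ[X]) : HasFDerivAt (fun z : (Fin n → ℂ) × ℂ => q.eval z.2)
      ((derivative q).eval r • ContinuousLinearMap.snd ℂ (Fin n → ℂ) ℂ) (A, r) :=
    HasDerivAt.comp_hasFDerivAt (x := (A, r)) (h₂ := fun x => q.eval x) (f := Prod.snd)
      (q.hasDerivAt r) hasFDerivAt_snd
  have hc (i : Fin n) : HasFDerivAt (fun z : (Fin n → ℂ) × ℂ => z.1 i)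
      ((ContinuousLinearMap.proj i).comp (ContinuousLinearMap.fst ℂ (Fin n → ℂ) ℂ)) (A, r) :=
    ((ContinuousLinearMap.proj i).comp (ContinuousLinearMap.fst ℂ (Fin n → ℂ) ℂ)).hasFDerivAt
  have hs := (h q).add (HasFDerivAt.fun_sum fun i (_ : i ∈ Finset.univ) => (hc i).mul (h (p i)))
  refine ⟨(derivative q).eval r • ContinuousLinearMap.snd ℂ (Fin n → ℂ) ℂ +
      ∑ i, (A i • (derivative (p i)).eval r • ContinuousLinearMap.snd ℂ (Fin n → ℂ) ℂ +
        (p i).eval r • (ContinuousLinearMap.proj i).comp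
          (ContinuousLinearMap.fst ℂ (Fin n → ℂ) ℂ)), ?_, ?_⟩
  · convert! hs using 1
    ext z
    simp [eval_finsetSum]
  · intro v y
    simp [eval_finsetSum, Finset.sum_add_distrib, Finset.mul_sum, mul_add]
    have e1 : ∑ i, A i * (eval r (derivative (p i)) * y) =
        ∑ i, y * (A i * eval r (derivative (p i))) := Finset.sum_congr rfl fun i _ => by ring
    have e2 : ∑ i, eval r (p i) * v i = ∑ i, v i * eval r (p i) :=
      Finset.sum_congr rfl fun i _ => mul_comm _ _
    rw [e1, e2]
    ring

theorem derivative_monicPoly {n : ℕ} (a : Fin n → ℂ) : derivative (monicPoly a) =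
    derivative (X ^ n) + ∑ i : Fin n, C (a i) * derivative (X ^ (n - 1 - (i : ℕ))) := by
  simp [monicPoly]

open scoped ContDiff in
theorem contDiff_eval_monicPoly (n : ℕ) :
    ContDiff ℂ ω fun z : (Fin n → ℂ) × ℂ => (monicPoly z.1).eval z.2 :=
  contDiff_eval_family _ _

open scoped ContDiff in
theorem contDiff_eval_derivative_monicPoly (n : ℕ) :
    ContDiff ℂ ω fun z : (Fin n → ℂ) × ℂ => (derivative (monicPoly z.1)).eval z.2 := by
  simp only [derivative_monicPoly]
  exact contDiff_eval_family _ _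

theorem continuous_eval_monicPoly (n : ℕ) :
    Continuous fun z : (Fin n → ℂ) × ℂ => (monicPoly z.1).eval z.2 :=
  (contDiff_eval_monicPoly n).continuous

theorem continuous_eval_derivative_monicPoly (n : ℕ) :
    Continuous fun z : (Fin n → ℂ) × ℂ => (derivative (monicPoly z.1)).eval z.2 :=
  (contDiff_eval_derivative_monicPoly n).continuous

/-- Compactness: roots stay in a fixed ball, and away from `r` one of `P_A`, `P_A'` is nonzero,
which persists nearby. -/
theorem eventually_common_roots_mem {n : ℕ} {A : Fin n → ℂ} {r : ℂ}
    (hr : ∀ x, (monicPoly A).eval x = 0 → (derivative (monicPoly A)).eval x = 0 → x = r)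
    {U : Set ((Fin n → ℂ) × ℂ)} (hU : U ∈ 𝓝 (A, r)) :
    ∀ᶠ a in 𝓝 A, ∀ x, (monicPoly a).eval x = 0 → (derivative (monicPoly a)).eval x = 0 →
      (a, x) ∈ U := by
  -- Roots of `P_a` have norm at most `‖a‖ + 1`, which is below `‖A‖ + 2` for `a` near `A`.
  have key : ∀ x ∈ Metric.closedBall (0 : ℂ) (‖A‖ + 2), ∀ᶠ z : (Fin n → ℂ) × ℂ in 𝓝 (A, x),
      (monicPoly z.1).eval z.2 = 0 → (derivative (monicPoly z.1)).eval z.2 = 0 → z ∈ U := by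
    intro x _
    by_cases hx : x = r
    · subst hx
      filter_upwards [hU] with z hz _ _ using hz
    · by_cases h0 : (monicPoly A).eval x = 0
      · have h1 : (derivative (monicPoly A)).eval x ≠ 0 := fun h => hx (hr x h0 h)
        filter_upwards [(continuous_eval_derivative_monicPoly n).continuousAt.eventually_ne
          (x := (A, x)) h1] with z hz _ h using absurd h hz
      · filter_upwards [(continuous_eval_monicPoly n).continuousAt.eventually_ne
          (x := (A, x)) h0] with z hz h using absurd h hz
  have hK := (isCompact_closedBall (0 : ℂ) (‖A‖ + 2)).eventually_forall_of_forall_eventually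
    (P := fun a x => (monicPoly a).eval x = 0 → (derivative (monicPoly a)).eval x = 0 → (a, x) ∈ U)
    key
  have hb : ∀ᶠ a in 𝓝 A, ‖a‖ < ‖A‖ + 1 :=
    continuous_norm.continuousAt.eventually_lt continuousAt_const (by linarith)
  filter_upwards [hK, hb] with a ha hab x hx hx'
  refine ha x ?_ hx hx'
  rw [mem_closedBall_zero_iff]
  linarith [norm_le_of_isRoot hx]

/-! ### Graphs from the inverse function theorem -/

open scoped ContDiff in
theorem isLocallyAnalyticGraph_of_eval_ne_zero {n : ℕ} {A : Fin n → ℂ} {r : ℂ} {k : Fin n}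
    (h0 : (monicPoly A).eval r = 0) (h1 : (derivative (monicPoly A)).eval r = 0)
    (h2 : (derivative (derivative (monicPoly A))).eval r ≠ 0)
    (hr : ∀ x, (monicPoly A).eval x = 0 → (derivative (monicPoly A)).eval x = 0 → x = r)
    (hk : r ^ (n - 1 - (k : ℕ)) ≠ 0) :
    IsLocallyAnalyticGraph (discriminantSet n) A k := by
  let π : (Fin n → ℂ) →L[ℂ] ({j : Fin n // j ≠ k} → ℂ) :=
    ContinuousLinearMap.pi fun j => ContinuousLinearMap.proj (j : Fin n)
  have hπ (a : Fin n → ℂ) : omitCoeff k a = π a := rfl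
  let f : (Fin n → ℂ) × ℂ → ({j : Fin n // j ≠ k} → ℂ) × ℂ × ℂ := fun z =>
    (π z.1, (monicPoly z.1).eval z.2, (derivative (monicPoly z.1)).eval z.2)
  have hf : ContDiff ℂ ω f := (π.contDiff.comp contDiff_fst).prodMk
    ((contDiff_eval_monicPoly n).prodMk (contDiff_eval_derivative_monicPoly n))
  obtain ⟨L₀, hL₀, hL₀'⟩ := exists_hasFDerivAt_eval_family (X ^ n)
    (fun i : Fin n => X ^ (n - 1 - (i : ℕ))) A r
  obtain ⟨L₁, hL₁, hL₁'⟩ := exists_hasFDerivAt_eval_family (derivative (X ^ n))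
    (fun i : Fin n => derivative (X ^ (n - 1 - (i : ℕ)))) A r
  simp only [← derivative_monicPoly] at hL₁ hL₁'
  let L := (π.comp (ContinuousLinearMap.fst ℂ (Fin n → ℂ) ℂ)).prod (L₀.prod L₁)
  have hL : HasFDerivAt f L (A, r) :=
    (π.comp (ContinuousLinearMap.fst ℂ (Fin n → ℂ) ℂ)).hasFDerivAt.prodMk (hL₀.prodMk hL₁)
  have hinj : Function.Injective L := by
    rw [injective_iff_map_eq_zero]
    rintro ⟨v, y⟩ hv
    obtain ⟨hv0, hv1, hv2⟩ : π v = 0 ∧ L₀ (v, y) = 0 ∧ L₁ (v, y) = 0 := by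
      simpa [L] using hv
    have hvk (j : Fin n) (hj : j ≠ k) : v j = 0 := congrFun hv0 ⟨j, hj⟩
    have h1' : eval r (derivative
      (X ^ n + ∑ i : Fin n, C (A i) * X ^ (n - 1 - (i : ℕ)))) = 0 := h1
    -- Since `P_A'(r) = 0`, the `y` term drops out and only `v k * r ^ (n - 1 - k)` is left.
    rw [hL₀', h1', Finset.sum_eq_single k (fun j _ hj => by simp [hvk j hj]) (by simp)] at hv1
    have hvz : v = 0 := by
      ext j
      by_cases hj : j = k
      · subst hj
        simpa [hk, -pow_eq_zero_iff, -ne_eq] using hv1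
      · exact hvk j hj
    subst hvz
    rw [hL₁'] at hv2
    simp [h2] at hv2
    simp [hv2]
  have hrank : Module.finrank ℂ ((Fin n → ℂ) × ℂ) =
      Module.finrank ℂ (({j : Fin n // j ≠ k} → ℂ) × ℂ × ℂ) := by
    have := k.pos
    simp [Fintype.card_subtype_compl]
    omega
  let e : ((Fin n → ℂ) × ℂ) ≃L[ℂ] ({j : Fin n // j ≠ k} → ℂ) × ℂ × ℂ :=
    ((L : _ →ₗ[ℂ] _).linearEquivOfInjective hinj hrank).toContinuousLinearEquiv
  have he : HasFDerivAt f (e : ((Fin n → ℂ) × ℂ) →L[ℂ] ({j : Fin n // j ≠ k} → ℂ) × ℂ × ℂ)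
      (A, r) := hL
  have hω : (ω : WithTop ℕ∞) ≠ 0 := by simp
  let Φ := hf.contDiffAt.toOpenPartialHomeomorph f he hω
  have hΦ (z) : Φ z = f z := rfl
  have hmem : (A, r) ∈ Φ.source := hf.contDiffAt.mem_toOpenPartialHomeomorph_source he hω
  have hfA : f (A, r) = (π A, 0, 0) := by simp [f, h0, h1]
  have hmem' : (π A, 0, 0) ∈ Φ.target := hfA ▸ Φ.map_source hmem
  have hsymm : AnalyticAt ℂ Φ.symm (π A, 0, 0) :=
    hfA ▸ (hf.contDiffAt.to_localInverse he hω).analyticAt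
  -- The local inverse at `(b, 0, 0)` returns the point of `D` above `b` together with its multiple
  -- root.
  refine ⟨fun b => (Φ.symm (b, 0, 0)).1 k, ?_, ?_⟩
  · have h1 : AnalyticAt ℂ (fun b : {j : Fin n // j ≠ k} → ℂ => (b, (0 : ℂ), (0 : ℂ))) (π A) :=
      analyticAt_id.prod analyticAt_const
    have h2 : AnalyticAt ℂ (fun b : {j : Fin n // j ≠ k} → ℂ => Φ.symm (b, (0 : ℂ), (0 : ℂ))) (π A) :=
      AnalyticAt.comp (g := Φ.symm) hsymm h1
    exact (((ContinuousLinearMap.proj k).comp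
      (ContinuousLinearMap.fst ℂ (Fin n → ℂ) ℂ)).analyticAt _).comp h2
  · have ht : ∀ᶠ a in 𝓝 A, (π a, (0 : ℂ), (0 : ℂ)) ∈ Φ.target :=
      (by fun_prop : Continuous fun a => (π a, (0 : ℂ), (0 : ℂ))).continuousAt.eventually
        (Φ.open_target.mem_nhds hmem')
    filter_upwards [ht, eventually_common_roots_mem hr (Φ.open_source.mem_nhds hmem)] with a ha ha'
    rw [hπ, mem_discriminantSet_iff]
    constructor
    · rintro ⟨x, hx, hx'⟩
      have h := Φ.left_inv (ha' x hx hx')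
      rw [hΦ] at h
      simp only [f, hx, hx'] at h
      rw [h]
    · intro hak
      have h := Φ.right_inv ha
      rw [hΦ] at h
      obtain ⟨hz0, hz1, hz2⟩ : π (Φ.symm (π a, 0, 0)).1 = π a ∧ _ ∧ _ := by
        simpa only [f, Prod.mk.injEq] using h
      have hz : (Φ.symm (π a, 0, 0)).1 = a := by
        ext j
        by_cases hj : j = k
        · rw [hj, hak]
        · exact congrFun hz0 ⟨j, hj⟩
      rw [hz] at hz1 hz2
      exact ⟨_, hz1, hz2⟩

/-! ### Failure of the graph property at a zero double root -/

/-- Along `γ` the coordinates other than `k` have zero velocity, so by the chain rule `φ` of them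
does too, while `a_k` moves with velocity `c`. -/
theorem HasDerivAt.not_isLocallyAnalyticGraph {n : ℕ} {D : Set (Fin n → ℂ)} {k : Fin n} {c : ℂ}
    {γ : ℂ → Fin n → ℂ} (hγ : HasDerivAt γ (Pi.single k c) 0) (hc : c ≠ 0)
    (hD : ∀ s, γ s ∈ D) : ¬ IsLocallyAnalyticGraph D (γ 0) k := by
  rintro ⟨φ, hφ, h⟩
  have hπ : HasDerivAt (fun s => omitCoeff k (γ s)) 0 0 := by
    rw [hasDerivAt_pi]
    rintro ⟨j, hj⟩
    simpa [omitCoeff, hj] using (hasDerivAt_pi.1 hγ) j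
  have h1 : HasDerivAt (fun s => φ (omitCoeff k (γ s))) 0 0 := by
    have h := HasFDerivAt.comp_hasDerivAt (l := φ) (f := fun s => omitCoeff k (γ s)) (0 : ℂ)
      hφ.differentiableAt.hasFDerivAt hπ
    rw [map_zero] at h
    exact h
  have h2 : HasDerivAt (fun s => γ s k) c 0 := by simpa using (hasDerivAt_pi.1 hγ) k
  have h3 : (fun s => γ s k) =ᶠ[𝓝 0] fun s => φ (omitCoeff k (γ s)) := by
    filter_upwards [hγ.continuousAt.eventually h] with s hs using hs.1 (hD s)
  exact hc (h2.unique (h1.congr_of_eventuallyEq h3))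

theorem not_isLocallyAnalyticGraph_of_root_zero {n : ℕ} {A : Fin n → ℂ} {k : Fin n}
    (h0 : (monicPoly A).eval 0 = 0) (h1 : (derivative (monicPoly A)).eval 0 = 0)
    (h2 : (derivative (derivative (monicPoly A))).eval 0 ≠ 0) (hk : (k : ℕ) + 1 < n) :
    ¬ IsLocallyAnalyticGraph (discriminantSet n) A k := by
  have hdeg {m : ℕ} (hm : m < n) : (X ^ m : ℂ[X]).degree < (n : WithBot ℕ) := by
    rw [degree_X_pow]
    exact_mod_cast hm
  rcases (by omega : n - 1 - (k : ℕ) = 1 ∨ 2 ≤ n - 1 - (k : ℕ)) with he | he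
  · set P := monicPoly A with hP
    -- Only the coefficients of `x` and `1` are changed, so as to make `s` a double root. The
    -- constant correction `s P'(s) - P(s)` has derivative `s P''(s)`, zero at `s = 0`.
    let γ : ℂ → Fin n → ℂ := fun s => A + (-(derivative P).eval s) • coeffVec n (X ^ (n - 1 - (k : ℕ)))
      + (s * (derivative P).eval s - P.eval s) • coeffVec n (X ^ 0)
    have hγ : HasDerivAt γ (Pi.single k (-(derivative (derivative P)).eval 0)) 0 := by
      have e1 := ((derivative P).hasDerivAt 0).neg.smul_const
        (coeffVec n (X ^ (n - 1 - (k : ℕ))))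
      have e2 := (((hasDerivAt_id (0 : ℂ)).mul ((derivative P).hasDerivAt 0)).sub
        (P.hasDerivAt 0)).smul_const (coeffVec n (X ^ 0))
      convert! (e1.const_add A).add e2 using 1
      rw [coeffVec_X_pow, ← Pi.single_smul]
      simp [h1]
    have h := hγ.not_isLocallyAnalyticGraph (D := discriminantSet n) (neg_ne_zero.2 h2) fun s => by
      rw [mem_discriminantSet_iff]
      have : monicPoly (γ s) = P + C (-(derivative P).eval s) * X ^ 1 +
          C (s * (derivative P).eval s - P.eval s) * X ^ 0 := by
        simp only [γ, ← map_smul]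
        rw [monicPoly_add_coeffVec, monicPoly_add_coeffVec, he, smul_eq_C_mul, smul_eq_C_mul]
        · exact (degree_smul_le _ _).trans_lt (hdeg (by omega))
        · exact (degree_smul_le _ _).trans_lt (hdeg (by omega))
      refine ⟨s, ?_, ?_⟩ <;> simp [this]
      ring
    simpa [γ, h0, h1] using h
  -- Adding a multiple of `x ^ j` with `j ≥ 2` keeps `0` a multiple root.
  · let γ : ℂ → Fin n → ℂ := fun s => A + s • coeffVec n (X ^ (n - 1 - (k : ℕ)))
    have hγ : HasDerivAt γ (Pi.single k 1) 0 := by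
      convert! ((hasDerivAt_id (0 : ℂ)).smul_const
        (coeffVec n (X ^ (n - 1 - (k : ℕ))))).const_add A using 1
      rw [coeffVec_X_pow, one_smul]
    have h := hγ.not_isLocallyAnalyticGraph (D := discriminantSet n) one_ne_zero fun s => by
      rw [mem_discriminantSet_iff]
      have : monicPoly (γ s) = monicPoly A + C s * X ^ (n - 1 - (k : ℕ)) := by
        simp only [γ, ← map_smul]
        rw [monicPoly_add_coeffVec, smul_eq_C_mul]
        exact (degree_smul_le _ _).trans_lt (hdeg (by omega))
      refine ⟨0, ?_, ?_⟩
      · simp [this, h0, zero_pow (by omega : n - 1 - (k : ℕ) ≠ 0)]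
      · simp [this, h1, derivative_X_pow, zero_pow (by omega : n - 1 - (k : ℕ) - 1 ≠ 0)]
    simpa [γ] using h

/-! ### Differentials along curves of higher order -/

open Asymptotics in
theorem eq_zero_of_isBigO_sq {α β : ℂ}
    (h : (fun s : ℂ => α + s * β) =O[𝓝[≠] 0] fun s => s ^ 2) : α = 0 ∧ β = 0 := by
  have t1 : Filter.Tendsto (fun s : ℂ => α + s * β) (𝓝[≠] 0) (𝓝 α) :=
    ((by fun_prop : Continuous fun s : ℂ => α + s * β).tendsto' 0 α (by simp)).mono_left
      nhdsWithin_le_nhds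
  have t2 : Filter.Tendsto (fun s : ℂ => s ^ 2) (𝓝[≠] 0) (𝓝 0) :=
    ((by fun_prop : Continuous fun s : ℂ => s ^ 2).tendsto' 0 0 (by simp)).mono_left
      nhdsWithin_le_nhds
  have hα : α = 0 := tendsto_nhds_unique t1 (h.trans_tendsto t2)
  subst hα
  refine ⟨rfl, ?_⟩
  have h' : (fun _ : ℂ => β) =O[𝓝[≠] 0] fun s : ℂ => s := by
    refine ((isBigO_refl (fun s : ℂ => s⁻¹) (𝓝[≠] 0)).mul h).congr' ?_ ?_
    · filter_upwards [self_mem_nhdsWithin] with s (hs : s ≠ 0)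
      field_simp
      ring
    · filter_upwards [self_mem_nhdsWithin] with s (hs : s ≠ 0)
      field_simp
  exact tendsto_nhds_unique tendsto_const_nhds
    (h'.trans_tendsto (Filter.tendsto_id.mono_left nhdsWithin_le_nhds))

open Asymptotics in
theorem AnalyticAt.isBigO_sub_fderiv {E : Type*} [NormedAddCommGroup E] [NormedSpace ℂ E]
    {f : E → ℂ} {x : E} (hf : AnalyticAt ℂ f x) :
    (fun y => f (x + y) - (f x + fderiv ℂ f x y)) =O[𝓝 0] fun y => ‖y‖ ^ 2 := by
  obtain ⟨p, hp⟩ := hf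
  refine (hp.isBigO_sub_partialSum_pow 2).congr_left fun y => ?_
  rw [hp.fderiv_eq, FormalMultilinearSeries.partialSum, Finset.sum_range_succ,
    Finset.sum_range_one, hp.coeff_zero]
  rfl

-- The first-order expansion gives `s ^ m * (df v + s * df w) = O(s ^ (2 * m))`. After division by
-- `s ^ m`, the error is `O(s ^ 2)` because `m ≥ 2`, so both coefficients vanish.
open Asymptotics in
theorem AnalyticAt.fderiv_eq_zero_of_vanish_on_curve {E : Type*} [NormedAddCommGroup E]
    [NormedSpace ℂ E] {f : E → ℂ} {x v w : E} {m : ℕ} (hf : AnalyticAt ℂ f x) (hx : f x = 0)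
    (hm : 2 ≤ m) (h : ∀ᶠ s : ℂ in 𝓝 0, f (x + s ^ m • (v + s • w)) = 0) :
    fderiv ℂ f x v = 0 ∧ fderiv ℂ f x w = 0 := by
  have hbd : (fun s : ℂ => s ^ m • (v + s • w)) =O[𝓝 0] fun s : ℂ => s ^ m := by
    have h1 : (fun s : ℂ => v + s • w) =O[𝓝 0] fun _ => (1 : ℂ) :=
      ((by fun_prop : Continuous fun s : ℂ => v + s • w).tendsto 0).isBigO_one ℂ
    simpa using (isBigO_refl (fun s : ℂ => s ^ m) (𝓝 0)).smul h1
  have ht : Filter.Tendsto (fun s : ℂ => s ^ m • (v + s • w)) (𝓝 0) (𝓝 0) :=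
    (by fun_prop : Continuous fun s : ℂ => s ^ m • (v + s • w)).tendsto' 0 0
      (by simp [zero_pow (by omega : m ≠ 0)])
  have h1 := (hf.isBigO_sub_fderiv.comp_tendsto ht).trans (hbd.norm_left.pow 2)
  have h2 : (fun s : ℂ => s ^ m * (fderiv ℂ f x v + s * fderiv ℂ f x w)) =O[𝓝 0]
      fun s : ℂ => s ^ m * s ^ m := by
    refine h1.neg_left.congr' ?_ (.of_forall fun s => by ring)
    filter_upwards [h] with s hs
    simp only [Function.comp_apply, hs, hx, map_smul, map_add, smul_eq_mul]
    ring
  have h3 : (fun s : ℂ => fderiv ℂ f x v + s * fderiv ℂ f x w) =O[𝓝[≠] 0]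
      fun s : ℂ => s ^ m := by
    refine ((isBigO_refl (fun s : ℂ => (s ^ m)⁻¹) (𝓝[≠] 0)).mul
      (h2.mono nhdsWithin_le_nhds)).congr' ?_ ?_ <;>
    · filter_upwards [self_mem_nhdsWithin] with s (hs : s ≠ 0)
      field_simp
  have h4 : (fun s : ℂ => s ^ m) =O[𝓝[≠] 0] fun s : ℂ => s ^ 2 := by
    have h5 : (fun s : ℂ => s ^ (m - 2)) =O[𝓝[≠] 0] fun _ => (1 : ℂ) :=
      (((continuous_pow (m - 2)).tendsto (0 : ℂ)).mono_left nhdsWithin_le_nhds).isBigO_one ℂ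
    refine (h5.mul (isBigO_refl (fun s : ℂ => s ^ 2) (𝓝[≠] 0))).congr
      (fun s => ?_) (fun s => one_mul _)
    rw [← pow_add, Nat.sub_add_cancel hm]
  exact eq_zero_of_isBigO_sq (h3.trans h4)

/-! ### Non-smoothness at roots of multiplicity at least three -/

theorem sq_dvd_of_eval_eq_zero {p : ℂ[X]} {r : ℂ} (h0 : p.eval r = 0)
    (h1 : (derivative p).eval r = 0) : (X - C r) ^ 2 ∣ p := by
  obtain ⟨g, rfl⟩ := dvd_iff_isRoot.2 h0
  have hg : g.IsRoot r := by simpa using h1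
  rw [sq]
  exact mul_dvd_mul_left _ (dvd_iff_isRoot.2 hg)

theorem not_isSmoothHypersurfaceAt_discriminantSet {n : ℕ} {A : Fin n → ℂ} {r : ℂ}
    (hA : A ∈ discriminantSet n) (hr : 3 ≤ (monicPoly A).rootMultiplicity r) :
    ¬ IsSmoothHypersurfaceAt (discriminantSet n) A := by
  rintro ⟨f, hf, hdf, hD⟩
  have hfA : f A = 0 := hD.self_of_nhds.1 hA
  obtain ⟨q, hq, hqr⟩ :=
    exists_eq_pow_rootMultiplicity_mul_and_not_dvd _ (monicPoly_monic A).ne_zero r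
  obtain ⟨m, hm⟩ : ∃ m, (monicPoly A).rootMultiplicity r = m + 1 := 
    Nat.exists_eq_succ_of_ne_zero (by omega)
  rw [hm] at hq hr
  rw [dvd_iff_isRoot, IsRoot.def] at hqr
  have hq0 : q ≠ 0 := by
    rintro rfl
    simp at hqr
  have hqdeg : m + 1 + q.natDegree = n := by
    rw [← natDegree_monicPoly A, hq, natDegree_mul (pow_ne_zero _ (X_sub_C_ne_zero r)) hq0,
      natDegree_pow, natDegree_X_sub_C, mul_one]
  have hdeg {p : ℂ[X]} (hp : p.natDegree < n) : p.degree < (n : WithBot ℕ) :=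
    degree_le_natDegree.trans_lt (by exact_mod_cast hp)
  have hyq : ((X - C r) * q).natDegree < n := by
    rw [natDegree_mul (X_sub_C_ne_zero r) hq0, natDegree_X_sub_C]
    omega
  -- Adding multiples of `(X - C r) ^ 2 * g` keeps `r` a multiple root, so the whole line lies in
  -- `D`.
  have hline (g : ℂ[X]) (hg : ((X - C r) ^ 2 * g).degree < (n : WithBot ℕ)) :
      fderiv ℂ f A (coeffVec n ((X - C r) ^ 2 * g)) = 0 := by
    set v := coeffVec n ((X - C r) ^ 2 * g) with hv
    have hγ : HasDerivAt (fun s : ℂ => A + s • v) v 0 := by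
      simpa using ((hasDerivAt_id (0 : ℂ)).smul_const v).const_add A
    have h1 : HasDerivAt (fun s : ℂ => f (A + s • v)) (fderiv ℂ f A v) 0 := by
      have hf' : HasFDerivAt f (fderiv ℂ f A) (A + (0 : ℂ) • v) := by
        simpa using hf.differentiableAt.hasFDerivAt
      exact HasFDerivAt.comp_hasDerivAt (f := fun s : ℂ => A + s • v) (0 : ℂ) hf' hγ
    have h2 : (fun s : ℂ => f (A + s • v)) =ᶠ[𝓝 0] fun _ => 0 := by
      have hc : Filter.Tendsto (fun s : ℂ => A + s • v) (𝓝 0) (𝓝 A) := by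
        simpa using hγ.continuousAt.tendsto
      filter_upwards [hc.eventually hD] with s hs
      refine hs.1 (mem_discriminantSet_iff.2 ⟨r, ?_⟩)
      have : monicPoly (A + s • v) = (X - C r) ^ (m + 1) * q + C s * ((X - C r) ^ 2 * g) := by
        rw [hv, ← map_smul, monicPoly_add_coeffVec _ ((degree_smul_le _ _).trans_lt hg), hq,
          smul_eq_C_mul]
      have hm0 : m ≠ 0 := by omega
      constructor <;> simp [this, derivative_pow, hm0]
    exact h1.unique ((hasDerivAt_const (0 : ℂ) (0 : ℂ)).congr_of_eventuallyEq h2)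
  -- With `y = x - r`, the factor `y^(m+1)` is deformed to `y^(m+1) - (m+1) s^m y + m s^(m+1)`,
  -- which vanishes with its derivative at `y = s`.
  have hcurve := hf.fderiv_eq_zero_of_vanish_on_curve (m := m)
    (v := coeffVec n (C (-(m + 1 : ℂ)) * ((X - C r) * q))) (w := coeffVec n (C (m : ℂ) * q))
    hfA (by omega) <| by
      have hc : Filter.Tendsto (fun s : ℂ => A + s ^ m • (coeffVec n (C (-(m + 1 : ℂ)) *
          ((X - C r) * q)) + s • coeffVec n (C (m : ℂ) * q))) (𝓝 0) (𝓝 A) :=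
        (by fun_prop : Continuous _).tendsto' 0 A (by simp [zero_pow (by omega : m ≠ 0)])
      filter_upwards [hc.eventually hD] with s hs
      refine hs.1 (mem_discriminantSet_iff.2 ⟨r + s, ?_⟩)
      have : monicPoly (A + s ^ m • (coeffVec n (C (-(m + 1 : ℂ)) *
          ((X - C r) * q)) + s • coeffVec n (C (m : ℂ) * q))) =
          ((X - C r) ^ (m + 1) - C ((m + 1) * s ^ m) * (X - C r) + C (m * s ^ (m + 1))) * q := by
        rw [← map_smul, ← map_add, ← map_smul, monicPoly_add_coeffVec, hq]
        · simp only [smul_eq_C_mul, map_mul, map_neg, map_add, map_pow, map_natCast, map_one]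
          ring
        · refine (degree_smul_le _ _).trans_lt ((degree_add_le _ _).trans_lt (max_lt ?_ ?_))
          · exact hdeg ((natDegree_C_mul_le _ _).trans_lt hyq)
          · exact (degree_smul_le _ _).trans_lt
              (hdeg ((natDegree_C_mul_le _ _).trans_lt (by omega)))
      constructor
      · rw [this]
        simp only [eval_mul, eval_add, eval_sub, eval_pow, eval_X, eval_C, add_sub_cancel_left]
        ring
      · rw [this, derivative_mul]
        simp only [derivative_add, derivative_sub, derivative_pow, derivative_mul, derivative_X,
          derivative_C, eval_mul, eval_add, eval_sub, eval_pow, eval_X, eval_C,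
          add_sub_cancel_left, Nat.cast_add, Nat.cast_one, Nat.add_sub_cancel, eval_zero, eval_one]
        ring
  have hm1 : (m : ℂ) ≠ 0 := by exact_mod_cast (by omega : m ≠ 0)
  have hm2 : (m + 1 : ℂ) ≠ 0 := by exact_mod_cast (by omega : m + 1 ≠ 0)
  obtain ⟨hc1, hc2⟩ := hcurve
  rw [← smul_eq_C_mul, map_smul, map_smul, smul_eq_mul] at hc1 hc2
  replace hc1 := (mul_eq_zero.1 hc1).resolve_left (neg_ne_zero.2 hm2)
  replace hc2 := (mul_eq_zero.1 hc2).resolve_left hm1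
  refine hdf (ContinuousLinearMap.ext fun v => ?_)
  rw [← coeffVec_sum v]
  have hp := degree_sum_lt v
  set p := ∑ i : Fin n, C (v i) * X ^ (n - 1 - (i : ℕ)) with hpdef
  -- `α + β (x - r)` is the first-order Taylor polynomial of `p / q` at `r`, so subtracting its
  -- product with `q` from `p` leaves a multiple of `(x - r)^2`.
  set α := p.eval r / q.eval r with hα
  set β := ((derivative p).eval r - α * (derivative q).eval r) / q.eval r with hβ
  obtain ⟨g, hg⟩ : (X - C r) ^ 2 ∣ p - (α • q + β • ((X - C r) * q)) := by
    apply sq_dvd_of_eval_eq_zero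
    · simp [hα, hqr]
    · simp [hβ, hqr]
  have hpg : p = (X - C r) ^ 2 * g + (α • q + β • ((X - C r) * q)) := by rw [← hg]; ring
  have hgdeg : ((X - C r) ^ 2 * g).degree < (n : WithBot ℕ) := by
    rw [← hg]
    refine (degree_sub_le _ _).trans_lt (max_lt hp ((degree_add_le _ _).trans_lt (max_lt ?_ ?_)))
    · exact (degree_smul_le _ _).trans_lt (hdeg (by omega))
    · exact (degree_smul_le _ _).trans_lt (hdeg hyq)
  rw [hpg]
  simp [hline g hgdeg, hc1, hc2]

/-! ### Translation of the multiplicity hypotheses and conclusion -/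

theorem HasDoubleRootOthersSimple.eval_eq_zero {P : ℂ[X]} {r : ℂ}
    (h : HasDoubleRootOthersSimple P r) (hP : P ≠ 0) :
    P.eval r = 0 ∧ (derivative P).eval r = 0 ∧ (derivative (derivative P)).eval r ≠ 0 := by
  obtain ⟨h0, h1⟩ := (one_lt_rootMultiplicity_iff_isRoot hP).1 (by rw [h.1]; norm_num)
  refine ⟨h0, h1, fun h2 => ?_⟩
  have h3 := (lt_rootMultiplicity_iff_isRoot_iterate_derivative (n := 2) (t := r) hP).2
    fun j hj => by
      interval_cases j
      exacts [h0, h1, h2]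
  rw [h.1] at h3
  omega

theorem HasDoubleRootOthersSimple.eq_of_eval_eq_zero {P : ℂ[X]} {r x : ℂ}
    (h : HasDoubleRootOthersSimple P r) (hP : P ≠ 0) (h0 : P.eval x = 0)
    (h1 : (derivative P).eval x = 0) : x = r := by
  by_contra hx
  have h2 := (one_lt_rootMultiplicity_iff_isRoot hP).2 ⟨h0, h1⟩
  rw [h.2 x hx h0] at h2
  omega

theorem eval_zero_of_last_coeff_eq_zero {n : ℕ} (hn : 2 ≤ n) {A : Fin n → ℂ}
    (hA : ∀ j : Fin n, n ≤ (j : ℕ) + 2 → A j = 0) :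
    (monicPoly A).eval 0 = 0 ∧ (derivative (monicPoly A)).eval 0 = 0 := by
  have hc (i : ℕ) (hi : i < 2) : (monicPoly A).coeff i = 0 := by
    have h := congrFun (coeffVec_monicPoly A) ⟨n - 1 - i, by omega⟩
    rw [hA _ (by simp; omega), coeffVec_apply] at h
    rwa [show n - 1 - (n - 1 - i) = i by omega] at h
  rw [← coeff_zero_eq_eval_zero, ← coeff_zero_eq_eval_zero, coeff_derivative]
  simp [hc]

theorem theorem1 (n : ℕ) (A : Fin n → ℂ) (hA : A ∈ discriminantSet n) :
    (∀ r : ℂ, HasDoubleRootOthersSimple (monicPoly A) r →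
      (r ≠ 0 →
        (¬ ∀ j : Fin n, n ≤ (j : ℕ) + 2 → A j = 0) ∧
        ∀ k : Fin n, IsLocallyAnalyticGraph (discriminantSet n) A k) ∧
      (r = 0 →
        (∀ k : Fin n, (k : ℕ) + 1 = n → IsLocallyAnalyticGraph (discriminantSet n) A k) ∧
        ∀ k : Fin n, (k : ℕ) + 1 < n → ¬ IsLocallyAnalyticGraph (discriminantSet n) A k)) ∧
    ((∃ r : ℂ, 3 ≤ (monicPoly A).rootMultiplicity r) →
      ¬ IsSmoothHypersurfaceAt (discriminantSet n) A) := by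
  refine ⟨fun r hr => ?_, fun ⟨r, hr⟩ => not_isSmoothHypersurfaceAt_discriminantSet hA hr⟩
  have hP := (monicPoly_monic A).ne_zero
  obtain ⟨h0, h1, h2⟩ := hr.eval_eq_zero hP
  have hu := fun x => hr.eq_of_eval_eq_zero (x := x) hP
  refine ⟨fun hr0 => ⟨fun hz => ?_, fun k => ?_⟩, ?_⟩
  · have hn : 2 ≤ n := by
      have h := natDegree_le_of_dvd (pow_rootMultiplicity_dvd (monicPoly A) r) hP
      rwa [hr.1, natDegree_pow, natDegree_X_sub_C, natDegree_monicPoly] at h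
    obtain ⟨hz0, hz1⟩ := eval_zero_of_last_coeff_eq_zero hn hz
    exact hr0 (hu 0 hz0 hz1).symm
  · exact isLocallyAnalyticGraph_of_eval_ne_zero h0 h1 h2 hu (pow_ne_zero _ hr0)
  · rintro rfl
    refine ⟨fun k hk => isLocallyAnalyticGraph_of_eval_ne_zero h0 h1 h2 hu ?_,
      fun k hk => not_isLocallyAnalyticGraph_of_root_zero h0 h1 h2 hk⟩
    -- For the last index the exponent is `0`, and `0 ^ 0 = 1` is nonzero.
    simp [(by omega : n - 1 - (k : ℕ) = 0)]
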